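/- All graphs are finite and simple. A graph is \emph{outerplanar} if it can be drawn in the plane without crossings so that all its vertices lie on the boundary of the outer face; equivalently, if its vertices can be placed at distinct points of a circle so that its edges, drawn as straight chords, do not cross. For $D\in\mathbb{N}$, a \emph{diameter-$D$ outerplanar completion} of a graph $G$ is an outerplanar graph $H$ with $V(H)=V(G)$, $E(G)\subseteq E(H)$ and diameter at most $D$. For a vertex $u$ of $G$ let $\mathrm{ecc}^*_D(u,G)$ be the minimum, over all diameter-$D$ outerplanar completions $H$ of $G$, of the eccentricity $\max_{w\in V(H)}\mathrm{dist}_H(u,w)$, and let $\mathrm{ecc}^*_D(u,G)=\infty$ if there is no such completion. If $v$ is a cut vertex of a connected graph $G$ and $C_1,\dots,C_t$ are the vertex sets of the connected components of $G-v$, then the sets $B_j=C_j\cup\{v\}$ are called the \emph{branches} of $G$ at $v$. \textbf{Corollary.} Let $D\in\mathbb{N}$, and let $G$ be a connected outerplanar graph with a cut vertex $v$ that belongs to $t\ge 8$ branches $B_1,\dots,B_t$, numbered so that $\mathrm{ecc}^*_D(v,G[B_1])\ge \mathrm{ecc}^*_D(v,G[B_2])\ge\dots\ge \mathrm{ecc}^*_D(v,G[B_t])$.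 Then for each $i$ with $8\le i\le t$, the graph $G_i=G\bigl[\bigcup_{j\in\{1,\dots,7,i\}}B_j\bigr]$ has a diameter-$D$ outerplanar completion if and only if $G$ does. -/

import Mathlib

namespace SimpleGraph

/-- A graph is outerplanar if it can be drawn in the plane without crossings and with every vertex
on the boundary of the outer face. In its convex form: the vertices are distinct points of the unit
circle, every edge is the straight chord between its ends, and no two different edges meet except
at a common end. -/
def IsOuterplanar {V : Type*} (G : SimpleGraph V) : Prop :=
  ∃ p : V → ℂ, Function.Injective p ∧ (∀ x, ‖p x‖ = 1) ∧
    ∀ a b c d : V, G.Adj a b → G.Adj c d → s(a, b) ≠ s(c, d) →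
      Disjoint (openSegment ℝ (p a) (p b)) (openSegment ℝ (p c) (p d))

/-- `H` is a diameter-`D` outerplanar completion of `G`: it is obtained from `G` by adding edges, it
is outerplanar, and its diameter (as an extended natural number, infinite when `H` is disconnected)
is at most `D`. -/
def IsDiamOuterplanarCompletion {V : Type*} (D : ℕ) (G H : SimpleGraph V) : Prop :=
  G ≤ H ∧ H.IsOuterplanar ∧ H.ediam ≤ (D : ℕ∞)

/-- `G` admits a diameter-`D` outerplanar completion. -/
def HasDiamOuterplanarCompletion {V : Type*} (D : ℕ) (G : SimpleGraph V) : Prop :=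
  ∃ H : SimpleGraph V, IsDiamOuterplanarCompletion D G H

/-- The least eccentricity of `u` in a diameter-`D` outerplanar completion of `G`; it is `⊤` when
there is no such completion. -/
noncomputable def minEccent {V : Type*} (D : ℕ) (G : SimpleGraph V) (u : V) : ℕ∞ :=
  ⨅ (H : SimpleGraph V) (_ : IsDiamOuterplanarCompletion D G H), H.eccent u

/-- The branch of `G` at `v` that belongs to a connected component `C` of `G - v`: the vertex set
of `C` together with `v`. -/
def branch {V : Type*} (G : SimpleGraph V) (v : V)
    (C : (G.induce ({v}ᶜ : Set V)).ConnectedComponent) : Set V :=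
  insert v (Subtype.val '' C.supp)

theorem mem_branch {V : Type*} (G : SimpleGraph V) (v : V)
    (C : (G.induce ({v}ᶜ : Set V)).ConnectedComponent) : v ∈ G.branch v C :=
  Set.mem_insert _ _

end SimpleGraph

/-! Outerplanarity is treated as a linear order of the vertices without crossing arcs, in which `v`
may be taken last. Contracting whole branches onto `v` preserves this (`NonCrossing.contract`) and
increases no distance, so a completion of `G` yields one of every union of branches, and a
completion of `G_i` yields a completion `H` of the union of the first seven.

Let `r` be the least eccentricity of `v` for the seventh branch. The key bound is `dist_H(z, v) + r
≤ D` for every `z` (`IsBranching.edist_add_le`). In each branch choose a neighbour of `v`, its root.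
Of seven roots at least three lie strictly on one side of `z`; call them `a`, `b`, `c`, going away
from `z`. The branch of `c` has a vertex `x` at distance at least `r` from everything outside that
branch and from `v`. The chords from `v` to `a` and to `b` separate `z` from `x`, so a path from `z`
to `x` first spends at least `dist(z, v)` steps to get to `v` or `b`, and then at least `r` more.

Hence every later branch, in a completion where `v` has eccentricity at most `r`, can be glued to
`H` at `v` without exceeding diameter `D` (`hasDiamOuterplanarCompletion_of_pieces`). -/

namespace SimpleGraph

/-! ### Chords of the unit circle and signed areas -/

/-- Twice the signed area of the triangle `p q r`. -/
def signedArea (p q r : ℂ) : ℝ :=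
  (q.re - p.re) * (r.im - p.im) - (q.im - p.im) * (r.re - p.re)

/-- The point of the unit circle at angle `θ`. -/
noncomputable def circlePoint (θ : ℝ) : ℂ := ⟨Real.cos θ, Real.sin θ⟩

theorem circlePoint_eq_exp (θ : ℝ) : circlePoint θ = Complex.exp (θ * Complex.I) := by
  apply Complex.ext <;> simp [circlePoint, Complex.exp_ofReal_mul_I_re, Complex.exp_ofReal_mul_I_im]

/-- With circumradius 1, twice the area is half the product of the sides, and a side is twice the
sine of half its arc. -/
theorem signedArea_circlePoint (a b c : ℝ) :
    signedArea (circlePoint a) (circlePoint b) (circlePoint c) =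
      4 * Real.sin ((b - a) / 2) * Real.sin ((c - b) / 2) * Real.sin ((c - a) / 2) := by
  set x := (b - a) / 2 with hx
  set y := (c - b) / 2 with hy
  have hb : b = a + 2 * x := by rw [hx]; ring
  have hc : c = a + 2 * (x + y) := by rw [hx, hy]; ring
  have hxy : (c - a) / 2 = x + y := by rw [hx, hy]; ring
  have hs : signedArea (circlePoint a) (circlePoint b) (circlePoint c) =
      Real.sin (2 * x) + Real.sin (2 * y) - Real.sin (2 * (x + y)) := by
    have e1 : 2 * x = b - a := by rw [hx]; ring
    have e2 : 2 * y = c - b := by rw [hy]; ring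
    have e3 : 2 * (x + y) = c - a := by rw [hx, hy]; ring
    rw [e1, e2, e3, Real.sin_sub, Real.sin_sub, Real.sin_sub]
    simp only [signedArea, circlePoint]
    ring
  rw [hs, hxy, Real.sin_two_mul, Real.sin_two_mul, Real.sin_two_mul, Real.sin_add, Real.cos_add]
  have h1 := Real.sin_sq_add_cos_sq x
  have h2 := Real.sin_sq_add_cos_sq y
  have h1' : Real.cos x ^ 2 = 1 - Real.sin x ^ 2 := by linarith
  have h2' : Real.cos y ^ 2 = 1 - Real.sin y ^ 2 := by linarith
  ring_nf
  simp only [h1', h2']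
  ring

theorem signedArea_circlePoint_pos {a b c : ℝ} (hab : a < b) (hbc : b < c)
    (hca : c < a + 2 * Real.pi) :
    0 < signedArea (circlePoint a) (circlePoint b) (circlePoint c) := by
  rw [signedArea_circlePoint]
  have h1 : 0 < Real.sin ((b - a) / 2) := Real.sin_pos_of_pos_of_lt_pi (by linarith) (by linarith)
  have h2 : 0 < Real.sin ((c - b) / 2) := Real.sin_pos_of_pos_of_lt_pi (by linarith) (by linarith)
  have h3 : 0 < Real.sin ((c - a) / 2) := Real.sin_pos_of_pos_of_lt_pi (by linarith) (by linarith)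
  positivity

theorem signedArea_rotate (p q r : ℂ) : signedArea q r p = signedArea p q r := by
  simp only [signedArea]; ring

theorem signedArea_swap (p q r : ℂ) : signedArea p r q = -signedArea p q r := by
  simp only [signedArea]; ring

theorem signedArea_combo (p q c d : ℂ) {s t : ℝ} (hst : s + t = 1) :
    signedArea p q (s • c + t • d) = s * signedArea p q c + t * signedArea p q d := by
  have : s = 1 - t := by linarith
  subst this
  simp [signedArea]; ring

theorem signedArea_self_left (p q : ℂ) : signedArea p q p = 0 := by
  simp [signedArea]

theorem signedArea_self_right (p q : ℂ) : signedArea p q q = 0 := by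
  simp only [signedArea]; ring

/-- Segments do not meet if the second one lies weakly on one side of the first and is not contained
in its line. -/
theorem disjoint_openSegment_of_signedArea_mul_nonneg {p q c d : ℂ}
    (h : (0 ≤ signedArea p q c ∧ 0 ≤ signedArea p q d) ∨
      (signedArea p q c ≤ 0 ∧ signedArea p q d ≤ 0))
    (hne : signedArea p q c ≠ 0 ∨ signedArea p q d ≠ 0) :
    Disjoint (openSegment ℝ p q) (openSegment ℝ c d) := by
  rw [Set.disjoint_left]
  rintro z ⟨s, t, hs, ht, hst, rfl⟩ ⟨s', t', hs', ht', hst', h'⟩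
  have h1 := signedArea_combo p q p q hst
  have h2 := signedArea_combo p q c d hst'
  rw [h', h1, signedArea_self_left, signedArea_self_right] at h2
  rcases h with ⟨h3, h4⟩ | ⟨h3, h4⟩ <;> rcases hne with h5 | h5
  · have := mul_pos hs' (lt_of_le_of_ne h3 h5.symm)
    have := mul_nonneg ht'.le h4
    linarith
  · have := mul_pos ht' (lt_of_le_of_ne h4 h5.symm)
    have := mul_nonneg hs'.le h3
    linarith
  · have := mul_neg_of_pos_of_neg hs' (lt_of_le_of_ne h3 h5)
    have := mul_nonpos_of_nonneg_of_nonpos ht'.le h4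
    linarith
  · have := mul_neg_of_pos_of_neg ht' (lt_of_le_of_ne h4 h5)
    have := mul_nonpos_of_nonneg_of_nonpos hs'.le h3
    linarith

/-- Diagonals of a convex quadrilateral inscribed in the unit circle meet. -/
theorem exists_mem_openSegment_circlePoint {a b c d : ℝ} (hab : a < b) (hbc : b < c) (hcd : c < d)
    (hda : d < a + 2 * Real.pi) :
    ∃ z, z ∈ openSegment ℝ (circlePoint a) (circlePoint c) ∧
      z ∈ openSegment ℝ (circlePoint b) (circlePoint d) := by
  have h1 := signedArea_circlePoint_pos hbc hcd (by linarith)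
  have h2 := signedArea_circlePoint_pos (hab.trans hbc) hcd hda
  have h3 := signedArea_circlePoint_pos hab (hbc.trans hcd) hda
  have h4 := signedArea_circlePoint_pos hab hbc (by linarith)
  set A := circlePoint a
  set B := circlePoint b
  set C := circlePoint c
  set E := circlePoint d
  have hS : signedArea B C E + signedArea A B E = signedArea A C E + signedArea A B C := by
    simp only [signedArea]; ring
  have hpos : 0 < signedArea B C E + signedArea A B E := by positivity
  -- The diagonal `BE` divides `AC` in the ratio of the triangles it cuts off, and symmetrically for
  -- `AC`. By `hS` both pairs of weights have the same sum, the area of the quadrilateral.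
  refine ⟨(signedArea B C E / (signedArea B C E + signedArea A B E)) • A +
      (signedArea A B E / (signedArea B C E + signedArea A B E)) • C,
    ⟨_, _, by positivity, by positivity, by field_simp, rfl⟩,
    ⟨signedArea A C E / (signedArea B C E + signedArea A B E),
      signedArea A B C / (signedArea B C E + signedArea A B E), by positivity, by positivity,
      by rw [← add_div, ← hS, div_self hpos.ne'], ?_⟩⟩
  have key : signedArea A C E • B + signedArea A B C • E =
      signedArea B C E • A + signedArea A B E • C := by
    apply Complex.ext <;> simp [signedArea] <;> ring
  simp only [div_eq_inv_mul, mul_smul, ← smul_add]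
  rw [key]

/-! ### Convex drawings versus noncrossing linear orders -/

/-- A placement of the vertices of `G` in a linear order such that no two edges, drawn as arcs above
the order, cross. -/
structure NonCrossing {V α : Type*} [LinearOrder α] (G : SimpleGraph V) (f : V → α) : Prop where
  injective : Function.Injective f
  not_lt : ∀ ⦃a b c d : V⦄, G.Adj a c → G.Adj b d → f a < f b → f b < f c → ¬ f c < f d

theorem IsOuterplanar.exists_nonCrossing {V : Type*} {G : SimpleGraph V} (h : G.IsOuterplanar)
    (v : V) : ∃ f : V → ℝ, G.NonCrossing f ∧ ∀ x, x ≠ v → f x < f v := by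
  obtain ⟨p, hp, hnorm, hd⟩ := h
  have h0 : ∀ x, p x ≠ 0 := fun x hx => by simpa [hx] using hnorm x
  -- The minus sign gives `v` the argument `π`, the maximum of the range `(-π, π]`.
  let f : V → ℝ := fun x => Complex.arg (-(p x / p v))
  have hf : ∀ x, p x = -p v * circlePoint (f x) := by
    intro x
    have h1 := Complex.norm_mul_exp_arg_mul_I (-(p x / p v))
    rw [norm_neg, norm_div, hnorm, hnorm, div_one, Complex.ofReal_one, one_mul] at h1
    rw [circlePoint_eq_exp, h1]
    have := h0 v
    field_simp
  have hinj : Function.Injective f := fun x y hxy => hp (by rw [hf x, hf y, hxy])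
  have hfv : f v = Real.pi := by
    simp [f, div_self (h0 v)]
  refine ⟨f, ⟨hinj, ?_⟩, ?_⟩
  · intro a b c d hac hbd h1 h2 h3
    have hlt : f d < f a + 2 * Real.pi := by
      have := Complex.arg_le_pi (-(p d / p v))
      have := Complex.neg_pi_lt_arg (-(p a / p v))
      simp only [f]; linarith
    obtain ⟨z, ⟨s, t, hs, ht, hst, hz⟩, ⟨s', t', hs', ht', hst', hz'⟩⟩ :=
      exists_mem_openSegment_circlePoint h1 h2 h3 hlt
    have hne : s(a, c) ≠ s(b, d) := by
      intro he
      rcases Sym2.eq_iff.mp he with ⟨rfl, -⟩ | ⟨rfl, -⟩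
      · exact lt_irrefl _ h1
      · exact lt_asymm h1 (h2.trans h3)
    refine Set.disjoint_left.mp (hd a c b d hac hbd hne) (show -p v * z ∈ _ from ?_) ?_
    · refine ⟨s, t, hs, ht, hst, ?_⟩
      rw [hf a, hf c, ← hz, mul_add, mul_smul_comm, mul_smul_comm]
    · refine ⟨s', t', hs', ht', hst', ?_⟩
      rw [hf b, hf d, ← hz', mul_add, mul_smul_comm, mul_smul_comm]
  · intro x hx
    rw [hfv]
    refine lt_of_le_of_ne (Complex.arg_le_pi _) fun h => hx (hinj ?_)
    rw [hfv]; exact h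

/-- A countable order embeds in `ℝ`, and `2 * arctan` wraps `ℝ` around the circle minus a point. The
sign of an area then tells whether a vertex lies between the ends of a chord. -/
theorem NonCrossing.isOuterplanar {V α : Type*} [LinearOrder α] [Countable V] {G : SimpleGraph V}
    {f : V → α} (h : G.NonCrossing f) : G.IsOuterplanar := by
  let _ : LinearOrder V := LinearOrder.lift' f h.injective
  obtain ⟨g⟩ := Order.embedding_from_countable_to_dense V ℝ
  let θ : V → ℝ := fun x => 2 * Real.arctan (g x)
  have hθ : ∀ {x y}, x < y → θ x < θ y := fun {x y} hxy => by
    have := Real.arctan_strictMono (g.strictMono hxy)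
    simp only [θ]; linarith
  have hb : ∀ x y, θ x < θ y + 2 * Real.pi := fun x y => by
    have := Real.arctan_lt_pi_div_two (g x)
    have := Real.neg_pi_div_two_lt_arctan (g y)
    simp only [θ]; linarith
  have hpos : ∀ {x y z}, x < y → y < z →
      0 < signedArea (circlePoint (θ x)) (circlePoint (θ y)) (circlePoint (θ z)) :=
    fun hxy hyz => signedArea_circlePoint_pos (hθ hxy) (hθ hyz) (hb _ _)
  have hnc : ∀ {a b c d : V}, G.Adj a c → G.Adj b d → a < b → b < c → ¬ c < d :=
    fun h1 h2 h3 h4 h5 => h.not_lt h1 h2 h3 h4 h5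
  have key : ∀ a b c d : V, G.Adj a b → G.Adj c d → s(a, b) ≠ s(c, d) → a < b → c < d →
      Disjoint (openSegment ℝ (circlePoint (θ a)) (circlePoint (θ b)))
        (openSegment ℝ (circlePoint (θ c)) (circlePoint (θ d))) := by
    intro a b c d hab hcd hne h1 h2
    have hin : ∀ x, a < x → x < b →
        signedArea (circlePoint (θ a)) (circlePoint (θ b)) (circlePoint (θ x)) < 0 := by
      intro x hx hx'
      have := hpos hx hx'
      rw [signedArea_swap] at this
      linarith
    have hout : ∀ x, x < a ∨ b < x →
        0 < signedArea (circlePoint (θ a)) (circlePoint (θ b)) (circlePoint (θ x)) := by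
      rintro x (hx | hx)
      · rw [signedArea_rotate]; exact hpos hx h1
      · exact hpos h1 hx
    have ha := signedArea_self_left (circlePoint (θ a)) (circlePoint (θ b))
    have hb' := signedArea_self_right (circlePoint (θ a)) (circlePoint (θ b))
    have hne' : ¬ (a = c ∧ b = d) := fun ⟨e1, e2⟩ => hne (by rw [e1, e2])
    have hc1 := @hnc a c b d hab hcd
    have hc2 := @hnc c a d b hcd hab
    apply disjoint_openSegment_of_signedArea_mul_nonneg
    · rcases lt_trichotomy c a with hca | rfl | hca
      · rcases lt_trichotomy d a with hda | rfl | hda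
        · exact Or.inl ⟨(hout c (Or.inl hca)).le, (hout d (Or.inl hda)).le⟩
        · exact Or.inl ⟨(hout c (Or.inl hca)).le, ha.ge⟩
        · rcases lt_trichotomy d b with hdb | rfl | hdb
          · exact absurd hdb (hc2 hca hda)
          · exact Or.inl ⟨(hout c (Or.inl hca)).le, hb'.ge⟩
          · exact Or.inl ⟨(hout c (Or.inl hca)).le, (hout d (Or.inr hdb)).le⟩
      · rcases lt_trichotomy d b with hdb | rfl | hdb
        · exact Or.inr ⟨ha.le, (hin d h2 hdb).le⟩
        · exact Or.inr ⟨ha.le, hb'.le⟩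
        · exact Or.inl ⟨ha.ge, (hout d (Or.inr hdb)).le⟩
      · rcases lt_trichotomy c b with hcb | rfl | hcb
        · rcases lt_trichotomy d b with hdb | rfl | hdb
          · exact Or.inr ⟨(hin c hca hcb).le, (hin d (hca.trans h2) hdb).le⟩
          · exact Or.inr ⟨(hin c hca hcb).le, hb'.le⟩
          · exact absurd hdb (hc1 hca hcb)
        · exact Or.inl ⟨hb'.ge, (hout d (Or.inr h2)).le⟩
        · exact Or.inl ⟨(hout c (Or.inr hcb)).le, (hout d (Or.inr (hcb.trans h2))).le⟩
    · have hz : ∀ x, signedArea (circlePoint (θ a)) (circlePoint (θ b)) (circlePoint (θ x)) = 0 →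
          x = a ∨ x = b := by
        intro x hx
        by_contra! hx'
        rcases lt_or_gt_of_ne hx'.1 with h | h
        · exact (hout x (Or.inl h)).ne' hx
        · rcases lt_or_gt_of_ne hx'.2 with h' | h'
          · exact (hin x h h').ne hx
          · exact (hout x (Or.inr h')).ne' hx
      by_contra! h0
      rcases hz c h0.1 with rfl | rfl <;> rcases hz d h0.2 with rfl | rfl
      · exact lt_irrefl _ h2
      · exact hne rfl
      · exact lt_asymm h1 h2
      · exact lt_irrefl _ h2
  refine ⟨fun x => circlePoint (θ x), ?_, ?_, ?_⟩
  · intro x y hxy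
    by_contra hne
    wlog hlt : x < y generalizing x y
    · exact this hxy.symm (Ne.symm hne) (lt_of_le_of_ne (_root_.not_lt.mp hlt) (Ne.symm hne))
    have h1 : 0 < Real.sin ((θ y - θ x) / 2) :=
      Real.sin_pos_of_pos_of_lt_pi (by have := hθ hlt; linarith) (by have := hb y x; linarith)
    have h2 : Real.cos (θ y - θ x) = 1 := by
      have e1 : Real.cos (θ x) = Real.cos (θ y) := by
        simpa only [circlePoint] using congrArg Complex.re hxy
      have e2 : Real.sin (θ x) = Real.sin (θ y) := by
        simpa only [circlePoint] using congrArg Complex.im hxy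
      rw [Real.cos_sub, e1, e2]
      have := Real.sin_sq_add_cos_sq (θ y)
      nlinarith
    have h3 : θ y - θ x = 2 * ((θ y - θ x) / 2) := by ring
    rw [h3, Real.cos_two_mul, Real.cos_sq'] at h2
    nlinarith
  · intro x
    simp only [circlePoint_eq_exp, Complex.norm_exp_ofReal_mul_I]
  · intro a b c d hab hcd hne
    rcases lt_or_gt_of_ne hab.ne with h1 | h1 <;> rcases lt_or_gt_of_ne hcd.ne with h2 | h2
    · exact key a b c d hab hcd hne h1 h2
    · rw [openSegment_symm ℝ (circlePoint (θ c))]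
      exact key a b d c hab hcd.symm (by rwa [Sym2.eq_swap (a := d)]) h1 h2
    · rw [openSegment_symm ℝ (circlePoint (θ a))]
      exact key b a c d hab.symm hcd (by rwa [Sym2.eq_swap (a := b)]) h1 h2
    · rw [openSegment_symm ℝ (circlePoint (θ a)), openSegment_symm ℝ (circlePoint (θ c))]
      exact key b a d c hab.symm hcd.symm (by rwa [Sym2.eq_swap (a := b), Sym2.eq_swap (a := d)])
        h1 h2

end SimpleGraph

namespace SimpleGraph

open Relation

/-! ### Contraction of a connected set -/

section Contraction

variable {W T : Type*}

/-- The graph obtained from `H` by identifying vertices along `r`. -/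
def contract (H : SimpleGraph W) (r : W → T) : SimpleGraph T where
  Adj a b := a ≠ b ∧ ∃ x y, r x = a ∧ r y = b ∧ H.Adj x y
  symm := ⟨fun _ _ ⟨h, x, y, hx, hy, hxy⟩ => ⟨h.symm, y, x, hy, hx, hxy.symm⟩⟩
  loopless := ⟨fun _ h => h.1 rfl⟩

theorem edist_le_edist_of_adj {H : SimpleGraph W} {H' : SimpleGraph T} {r : W → T}
    (hr : ∀ x y, H.Adj x y → r x = r y ∨ H'.Adj (r x) (r y)) (x y : W) :
    H'.edist (r x) (r y) ≤ H.edist x y := by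
  refine le_iInf fun p => ?_
  induction p with
  | nil => simp
  | @cons a b c h p ih =>
    rcases hr a b h with he | he
    · rw [he]
      refine ih.trans ?_
      simp
    · refine (SimpleGraph.edist_triangle (v := r b)).trans ?_
      rw [edist_eq_one_iff_adj.mpr he, Walk.length_cons, Nat.cast_add, add_comm]
      exact add_le_add ih le_rfl

theorem edist_contract_le (H : SimpleGraph W) (r : W → T) (x y : W) :
    (H.contract r).edist (r x) (r y) ≤ H.edist x y := by
  refine edist_le_edist_of_adj (fun a b h => ?_) x y
  by_cases he : r a = r b
  · exact Or.inl he
  · exact Or.inr ⟨he, a, b, rfl, rfl, h⟩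

theorem NonCrossing.between_of_adj {α : Type*} [LinearOrder α] {H : SimpleGraph W} {f : W → α}
    (hf : H.NonCrossing f) {a b x y : W} (hab : H.Adj a b) (hxy : H.Adj x y) (hya : y ≠ a)
    (hyb : y ≠ b) (hax : f a < f x) (hxb : f x < f b) : f a < f y ∧ f y < f b := by
  have h1 : f y ≠ f a := fun h => hya (hf.injective h)
  have h2 : f y ≠ f b := fun h => hyb (hf.injective h)
  constructor
  · by_contra h
    exact hf.not_lt hxy.symm hab (lt_of_le_of_ne (le_of_not_gt h) h1) hax hxb
  · by_contra h
    exact hf.not_lt hab hxy hax hxb (lt_of_le_of_ne (le_of_not_gt h) h2.symm)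

/-- Contracting a connected set of vertices onto the last vertex of a noncrossing order keeps the
order of the remaining vertices noncrossing. -/
theorem NonCrossing.contract {α : Type*} [LinearOrder α] {H : SimpleGraph W} {f : W → α}
    (hf : H.NonCrossing f) (ι : T → W) (r : W → T) (w : T) (hr : ∀ t, r (ι t) = t)
    (hfib : ∀ s, r s ≠ w → ι (r s) = s) (hmax : ∀ x, x ≠ ι w → f x < f (ι w))
    (hconn : ∀ s, r s = w → ReflTransGen (fun a b => H.Adj a b ∧ r b = w) s (ι w)) :
    (H.contract r).NonCrossing (f ∘ ι) := by
  have hι : Function.Injective ι := fun a b h => by rw [← hr a, h, hr]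
  refine ⟨hf.injective.comp hι, ?_⟩
  rintro a b c d ⟨hac, x, y, hx, hy, hxy⟩ ⟨hbd, x', y', hx', hy', hxy'⟩ h1 h2 h3
  simp only [Function.comp] at h1 h2 h3
  have hne : ∀ {s t : T}, f (ι s) < f (ι t) → s ≠ w := by
    rintro s t h rfl
    by_cases he : ι t = ι s
    · exact h.ne (by rw [he])
    · exact lt_asymm h (hmax _ he)
  have ex : x = ι a := by rw [← hx, hfib]; rw [hx]; exact hne h1
  have ey : y = ι c := by rw [← hy, hfib]; rw [hy]; exact hne h3
  have ex' : x' = ι b := by rw [← hx', hfib]; rw [hx']; exact hne h2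
  subst ex ey ex'
  -- Only `d` can be the contracted vertex, since the others lie below something. In that case `y'`
  -- is trapped under the arc from `a` to `c`, and so is everything its fibre connects it to,
  -- including the last vertex `ι w`.
  by_cases hd : d = w
  · subst hd
    have hfd : ∀ s, r s = d → s ≠ ι a ∧ s ≠ ι c := by
      intro s hs
      constructor
      · rintro rfl; rw [hr] at hs; exact hne h1 hs
      · rintro rfl; rw [hr] at hs; exact hne h3 hs
    have hy1 := hf.between_of_adj hxy hxy' (hfd _ hy').1 (hfd _ hy').2 h1 h2
    have hbetween : ∀ u, ReflTransGen (fun a b => H.Adj a b ∧ r b = d) y' u →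
        f (ι a) < f u ∧ f u < f (ι c) := by
      intro u hu
      induction hu with
      | refl => exact hy1
      | tail _ hbc ih => exact hf.between_of_adj hxy hbc.1 (hfd _ hbc.2).1 (hfd _ hbc.2).2 ih.1 ih.2
    exact lt_asymm h3 (hbetween _ (hconn y' hy')).2
  · have ey' : y' = ι d := by rw [← hy', hfib]; rwa [hy']
    subst ey'
    exact hf.not_lt hxy hxy' h1 h2 h3

end Contraction

/-! ### Separation by chords at the last vertex -/

section Separation

variable {W : Type*} {H : SimpleGraph W}

/-- With `v` last, an edge that jumps over `y` and avoids both ends would cross the arc `yv`. -/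
theorem NonCrossing.mem_support_of_lt {α : Type*} [LinearOrder α] {f : W → α}
    (hf : H.NonCrossing f) {v y : W} (hmax : ∀ x, x ≠ v → f x < f v) (hvy : H.Adj v y) {a b : W}
    (p : H.Walk a b) (ha : f a < f y) (hb : f y < f b) : v ∈ p.support ∨ y ∈ p.support := by
  by_contra! hcon
  obtain ⟨hv, hy⟩ := hcon
  induction p with
  | nil => exact lt_asymm ha hb
  | @cons a c b h p ih =>
    rw [Walk.support_cons, List.mem_cons, not_or] at hv hy
    have hcy : c ≠ y := fun e => hy.2 (e ▸ p.start_mem_support)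
    have hcv : c ≠ v := fun e => hv.2 (e ▸ p.start_mem_support)
    refine ih ?_ hb hv.2 hy.2
    by_contra hlt
    have h1 : f y < f c := lt_of_le_of_ne (le_of_not_gt hlt) fun e => hcy (hf.injective e.symm)
    exact lt_asymm ha (hf.between_of_adj hvy.symm h.symm (Ne.symm hy.1) (Ne.symm hv.1) h1
      (hmax c hcv)).1

/-- A path through `v` is clear. Otherwise it meets `y₂`, and before that `v` or `y₁`; in the latter
case the step or more from `y₁` to `y₂` pays for the edge from `y₁` to `v`, so `y₂` is at least as
far from `z` as `v` is. -/
theorem edist_add_le_edist_of_separating {v y₁ y₂ z u : W} {r : ℕ∞} (hy₁ : H.Adj v y₁)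
    (hne : y₁ ≠ y₂) (h₁ : ∀ p : H.Walk z y₂, v ∈ p.support ∨ y₁ ∈ p.support)
    (h₂ : ∀ p : H.Walk z u, v ∈ p.support ∨ y₂ ∈ p.support)
    (hrv : r ≤ H.edist v u) (hry : r ≤ H.edist y₂ u) : H.edist z v + r ≤ H.edist z u := by
  classical
  refine le_iInf fun p => ?_
  have split : ∀ {a b c : W} (p : H.Walk a b) (hc : c ∈ p.support),
      ((p.takeUntil c hc).length : ℕ∞) + (p.dropUntil c hc).length = p.length := by
    intro a b c p hc
    rw [← Nat.cast_add, ← Walk.length_append, Walk.take_spec]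
  have through : ∀ {a b c : W} (p : H.Walk a b), c ∈ p.support →
      H.edist a c + H.edist c b ≤ p.length := by
    intro a b c p hc
    rw [← split p hc]
    exact add_le_add (edist_le _) (edist_le _)
  rcases h₂ p with hp | hp
  · exact (add_le_add le_rfl hrv).trans (through p hp)
  · rw [← split p hp]
    refine add_le_add ?_ (hry.trans (edist_le _))
    rcases h₁ (p.takeUntil y₂ hp) with hq | hq
    · exact (self_le_add_right _ _).trans (through _ hq)
    · refine le_trans ?_ (through _ hq)
      refine (SimpleGraph.edist_triangle (v := y₁)).trans (add_le_add le_rfl ?_)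
      rw [edist_eq_one_iff_adj.mpr hy₁.symm]
      exact Order.one_le_iff_pos.mpr (edist_pos_of_ne hne)

end Separation

/-! ### Contracting and gluing branches -/

section Branching

variable {V I : Type*}

/-- `q` labels the vertices of `G` other than `v` by the components of `G - v`, and `y k` is a
neighbour of `v` in the component labelled `k`. -/
structure IsBranching (G : SimpleGraph V) (v : V) (q : V → I) (y : I → V) : Prop where
  label_eq : ∀ ⦃a b⦄, G.Adj a b → a ≠ v → b ≠ v → q a = q b
  label_root : ∀ k, q (y k) = k
  root_ne : ∀ k, y k ≠ v
  adj_root : ∀ k, G.Adj v (y k)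
  reach_root : ∀ x, x ≠ v → ReflTransGen (fun a b => G.Adj a b ∧ a ≠ v ∧ b ≠ v) x (y (q x))

/-- The union of `{v}` and all components with a label in `J`. -/
def branchUnion (v : V) (q : V → I) (J : Set I) : Set V := {x | x = v ∨ q x ∈ J}

theorem mem_branchUnion (v : V) (q : V → I) (J : Set I) : v ∈ branchUnion v q J := Or.inl rfl

/-- Contracting branches turns a supergraph of a union of branches into one of a smaller union. -/
theorem IsBranching.exists_contraction [Finite V] {W : Type*} {G : SimpleGraph V} {v : V}
    {q : V → I} {y : I → V} (hB : G.IsBranching v q y) {e : W → V} (he : Function.Injective e)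
    {J J' : Set I} (hJ : ∀ x, x ∈ Set.range e ↔ x ∈ branchUnion v q J) (hJJ : J' ⊆ J)
    {H : SimpleGraph W} (hGH : ∀ a b, G.Adj (e a) (e b) → H.Adj a b) (hout : H.IsOuterplanar) :
    ∃ (H' : SimpleGraph (branchUnion v q J')) (r : W → branchUnion v q J'),
      G.induce (branchUnion v q J') ≤ H' ∧ H'.IsOuterplanar ∧
      (∀ x, e x ∈ branchUnion v q J' → (r x : V) = e x) ∧
      (∀ x, e x ∉ branchUnion v q J' → (r x : V) = v) ∧
      ∀ a b, H'.edist (r a) (r b) ≤ H.edist a b := by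
  classical
  let w : branchUnion v q J' := ⟨v, mem_branchUnion v q J'⟩
  let r : W → branchUnion v q J' := fun x => if h : e x ∈ branchUnion v q J' then ⟨e x, h⟩ else w
  have hsub : ∀ x : branchUnion v q J', (x : V) ∈ Set.range e := fun x =>
    (hJ x).2 (x.2.imp id fun h => hJJ h)
  choose ι hι using hsub
  have hr1 : ∀ x, e x ∈ branchUnion v q J' → (r x : V) = e x := fun x h => by simp [r, h]
  have hr2 : ∀ x, e x ∉ branchUnion v q J' → r x = w := fun x h => by simp [r, h]
  have hrι : ∀ t, r (ι t) = t := fun t => Subtype.ext (by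
    rw [hr1 _ (by rw [hι]; exact t.2), hι])
  have hfib : ∀ s, r s ≠ w → ι (r s) = s := by
    intro s hs
    have hm : e s ∈ branchUnion v q J' := by
      by_contra h; exact hs (hr2 s h)
    exact he (by rw [hι, hr1 s hm])
  obtain ⟨f, hf, hmax⟩ := hout.exists_nonCrossing (ι w)
  have hιw : e (ι w) = v := hι w
  -- A discarded vertex reaches the root of its branch inside that branch, and the root is adjacent
  -- to `v`.
  have hconn : ∀ s, r s = w → ReflTransGen (fun a b => H.Adj a b ∧ r b = w) s (ι w) := by
    intro s hs
    by_cases hsv : s = ι w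
    · rw [hsv]
    have hesv : e s ≠ v := fun h => hsv (he (by rw [h, hιw]))
    have hout' : e s ∉ branchUnion v q J' := fun h => hesv (by rw [← hr1 s h, hs])
    have hsJ : q (e s) ∈ J := ((hJ _).1 ⟨s, rfl⟩).resolve_left hesv
    have hlift : ∀ b, ReflTransGen (fun a b => G.Adj a b ∧ a ≠ v ∧ b ≠ v) (e s) b →
        b ≠ v ∧ q b = q (e s) ∧ ∃ c, e c = b ∧
          ReflTransGen (fun a b => H.Adj a b ∧ r b = w) s c := by
      intro b hb
      induction hb with
      | refl => exact ⟨hesv, rfl, s, rfl, ReflTransGen.refl⟩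
      | @tail b c _ hbc ih =>
        obtain ⟨hb1, hb2, b', rfl, hb3⟩ := ih
        have hqc : q c = q (e s) := by rw [← hb2, hB.label_eq hbc.1 hb1 hbc.2.2]
        obtain ⟨c', rfl⟩ := (hJ c).2 (Or.inr (by rw [hqc]; exact hsJ))
        refine ⟨hbc.2.2, hqc, c', rfl, hb3.tail ⟨hGH _ _ hbc.1, hr2 _ fun h => hout' ?_⟩⟩
        exact Or.inr (by rw [← hqc]; exact h.resolve_left hbc.2.2)
    obtain ⟨-, -, c, hc, hsc⟩ := hlift _ (hB.reach_root (e s) hesv)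
    refine hsc.tail ⟨hGH _ _ ?_, hrι w⟩
    rw [hc, hιw]
    exact (hB.adj_root _).symm
  refine ⟨H.contract r, r, ?_, (hf.contract ι r w hrι hfib hmax hconn).isOuterplanar, hr1,
    fun x h => by rw [hr2 x h], fun a b => H.edist_contract_le r a b⟩
  intro a b hab
  refine ⟨hab.ne, ι a, ι b, hrι a, hrι b, hGH _ _ ?_⟩
  rw [hι, hι]
  exact hab

/-- A completion of a graph, all of whose pieces share only the vertex `v`, is obtained by gluing
completions of the pieces at `v`. -/
theorem hasDiamOuterplanarCompletion_of_pieces [Finite V] [LinearOrder I] {G : SimpleGraph V}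
    {v : V} {q : V → I} {D : ℕ} (hq : ∀ ⦃a b⦄, G.Adj a b → a ≠ v → b ≠ v → q a = q b) (e : I → ℕ∞)
    (hpiece : ∀ k, ∃ H : SimpleGraph (branchUnion v q {k}),
      IsDiamOuterplanarCompletion D (G.induce (branchUnion v q {k})) H ∧
        H.eccent ⟨v, mem_branchUnion v q {k}⟩ ≤ e k)
    (he : ∀ k l, k ≠ l → e k + e l ≤ D) : G.HasDiamOuterplanarCompletion D := by
  classical
  choose H hH hecc using hpiece
  choose F hF hFmax using fun k =>
    (hH k).2.1.exists_nonCrossing ⟨v, mem_branchUnion v q {k}⟩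
  let K : SimpleGraph V :=
    { Adj := fun x y => ∃ k, ∃ (hx : x ∈ branchUnion v q {k}) (hy : y ∈ branchUnion v q {k}),
        (H k).Adj ⟨x, hx⟩ ⟨y, hy⟩
      symm := ⟨fun _ _ ⟨k, hx, hy, h⟩ => ⟨k, hy, hx, h.symm⟩⟩
      loopless := ⟨fun _ ⟨k, _, _, h⟩ => h.ne rfl⟩ }
  -- The pieces are laid out as consecutive blocks, with the common vertex `v` after all of them.
  let f : V → WithTop (I ×ₗ ℝ) := fun x =>
    if x = v then ⊤ else ((toLex (q x, F (q x) ⟨x, Or.inr rfl⟩) : I ×ₗ ℝ) : WithTop (I ×ₗ ℝ))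
  have hfv : f v = ⊤ := if_pos rfl
  have hfx : ∀ {k x} (hx : x ∈ branchUnion v q {k}), x ≠ v →
      f x = ((toLex (k, F k ⟨x, hx⟩) : I ×ₗ ℝ) : WithTop (I ×ₗ ℝ)) := by
    intro k x hx hxv
    have : q x = k := hx.resolve_left hxv
    subst this
    exact if_neg hxv
  have hself : ∀ x, x ∈ branchUnion v q {q x} := fun x => Or.inr rfl
  have hne : ∀ {x y}, f x < f y → x ≠ v := by
    rintro x y h rfl
    rw [hfv] at h
    exact not_top_lt h
  have hlt : ∀ {k x y} (hx : x ∈ branchUnion v q {k}) (hy : y ∈ branchUnion v q {k}),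
      f x < f y → F k ⟨x, hx⟩ < F k ⟨y, hy⟩ := by
    intro k x y hx hy h
    have hxv := hne h
    by_cases hyv : y = v
    · subst hyv
      exact hFmax k _ fun h => hxv (congrArg Subtype.val h)
    · rw [hfx hx hxv, hfx hy hyv, WithTop.coe_lt_coe, Prod.Lex.toLex_lt_toLex] at h
      simpa using h
  have hNC : K.NonCrossing f := by
    constructor
    · intro x y hxy
      by_cases hxv : x = v
      · by_contra hne'
        have hyv : y ≠ v := fun h => hne' (hxv.trans h.symm)
        rw [hxv, hfv, hfx (hself y) hyv] at hxy
        exact WithTop.top_ne_coe hxy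
      · have hyv : y ≠ v := by
          rintro rfl
          rw [hfv, hfx (hself x) hxv] at hxy
          exact WithTop.coe_ne_top hxy
        have hxy' := hxy
        rw [hfx (hself x) hxv, hfx (hself y) hyv, WithTop.coe_inj] at hxy'
        have hqq : q x = q y := congrArg (fun z => (ofLex z).1) hxy'
        have hx : x ∈ branchUnion v q {q y} := Or.inr hqq
        rw [hfx hx hxv, hfx (hself y) hyv, WithTop.coe_inj] at hxy
        have h2 : F (q y) ⟨x, hx⟩ = F (q y) ⟨y, hself y⟩ := congrArg (fun z => (ofLex z).2) hxy
        exact congrArg Subtype.val ((hF (q y)).injective h2)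
    · rintro a b c d ⟨k, ha, hc, hac⟩ ⟨l, hb, hd, hbd⟩ h1 h2 h3
      -- The three vertices `a`, `b`, `c` are not `v`, so the block order gives `k ≤ l ≤ k`:
      -- crossing edges lie in one piece.
      have hkl : l = k := by
        have h1' := h1
        have h2' := h2
        rw [hfx ha (hne h1), hfx hb (hne h2), WithTop.coe_lt_coe, Prod.Lex.toLex_lt_toLex] at h1'
        rw [hfx hb (hne h2), hfx hc (hne h3), WithTop.coe_lt_coe, Prod.Lex.toLex_lt_toLex] at h2'
        have e1 : k ≤ l := h1'.elim (fun h => h.le) fun h => h.1.le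
        have e2 : l ≤ k := h2'.elim (fun h => h.le) fun h => h.1.le
        exact le_antisymm e2 e1
      subst hkl
      exact (hF l).not_lt hac hbd (hlt ha hb h1) (hlt hb hc h2) (hlt hc hd h3)
  have hdist : ∀ {k x y} (hx : x ∈ branchUnion v q {k}) (hy : y ∈ branchUnion v q {k}),
      K.edist x y ≤ (H k).edist ⟨x, hx⟩ ⟨y, hy⟩ := fun {k x y} hx hy =>
    edist_le_edist_of_adj (H := H k) (H' := K) (r := Subtype.val)
      (fun a b h => Or.inr ⟨k, a.2, b.2, h⟩) ⟨x, hx⟩ ⟨y, hy⟩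
  refine ⟨K, ?_, hNC.isOuterplanar, ediam_le_of_edist_le fun x y => ?_⟩
  · intro x y hxy
    have hk : ∃ k, x ∈ branchUnion v q {k} ∧ y ∈ branchUnion v q {k} := by
      by_cases hxv : x = v
      · exact ⟨q y, Or.inl hxv, hself y⟩
      · by_cases hyv : y = v
        · exact ⟨q x, hself x, Or.inl hyv⟩
        · exact ⟨q x, hself x, Or.inr (hq hxy hxv hyv).symm⟩
    obtain ⟨k, hx, hy⟩ := hk
    exact ⟨k, hx, hy, (hH k).1 hxy⟩
  · by_cases hqq : q x = q y
    · have hx : x ∈ branchUnion v q {q y} := Or.inr hqq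
      exact (hdist hx (hself y)).trans (edist_le_ediam.trans (hH _).2.2)
    -- This also covers `x = v` or `y = v`: the label of `v` is immaterial, since `v` belongs to
    -- every piece.
    · refine (SimpleGraph.edist_triangle (v := v)).trans (le_trans ?_ (he _ _ hqq))
      refine add_le_add ?_ ?_
      · rw [SimpleGraph.edist_comm]
        exact (hdist (mem_branchUnion v q _) (hself x)).trans (edist_le_eccent.trans (hecc _))
      · exact (hdist (mem_branchUnion v q _) (hself y)).trans (edist_le_eccent.trans (hecc _))

end Branching

end SimpleGraph

namespace SimpleGraph

open Relation

variable {V I : Type*}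

/-! ### Far vertices and the bound from seven branches -/

theorem exists_completion_eccent_eq_minEccent {D : ℕ} {G : SimpleGraph V} {u : V}
    (h : G.minEccent D u ≠ ⊤) :
    ∃ H, IsDiamOuterplanarCompletion D G H ∧ H.eccent u = G.minEccent D u := by
  have hne : ∃ H, IsDiamOuterplanarCompletion D G H := by
    by_contra! hno
    exact h (by simp [minEccent, hno])
  have : Nonempty {H // IsDiamOuterplanarCompletion D G H} := hne.elim fun H hH => ⟨⟨H, hH⟩⟩
  obtain ⟨H, hH⟩ := ciInf_mem
    fun H : {H // IsDiamOuterplanarCompletion D G H} => H.1.eccent u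
  exact ⟨H.1, H.2, hH.trans iInf_subtype⟩

/-- In a completion of a union of branches, each of them has a vertex whose distance from everything
outside the branch is at least the least eccentricity of `v` in a completion of that branch. -/
theorem IsBranching.exists_far_vertex [Finite V] {G : SimpleGraph V} {v : V} {q : V → I} {y : I → V}
    (hB : G.IsBranching v q y) {D : ℕ} {J : Set I} {H : SimpleGraph (branchUnion v q J)}
    (hH : IsDiamOuterplanarCompletion D (G.induce (branchUnion v q J)) H) {k : I} (hk : k ∈ J) :
    ∃ x : branchUnion v q J, ((x : V) = v ∨ q x = k) ∧
      ∀ z : branchUnion v q J, (z : V) = v ∨ q z ≠ k →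
        minEccent D (G.induce (branchUnion v q {k})) ⟨v, mem_branchUnion v q {k}⟩ ≤
          H.edist z x := by
  -- Contracting all other branches leaves a completion of branch `k`. The required vertex is one
  -- farthest from `v` there; vertices outside the branch are mapped to `v`, so in `H` they are no
  -- closer to it.
  obtain ⟨H', r, hGH, hout, hr1, hr2, hdist⟩ := hB.exists_contraction
    (e := (Subtype.val : branchUnion v q J → V)) Subtype.val_injective (J := J) (J' := {k})
    (by simp) (by simpa using hk) hH.1 hH.2.1
  have hsub : ∀ x : branchUnion v q {k}, (x : V) ∈ branchUnion v q J := fun x =>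
    x.2.imp id fun h => by rw [Set.mem_singleton_iff.mp h]; exact hk
  have hrs : ∀ x : branchUnion v q {k}, r ⟨x, hsub x⟩ = x := fun x => Subtype.ext (hr1 _ x.2)
  have hcomp : IsDiamOuterplanarCompletion D (G.induce (branchUnion v q {k})) H' := by
    refine ⟨hGH, hout, ediam_le_of_edist_le fun a b => ?_⟩
    have := hdist ⟨a, hsub a⟩ ⟨b, hsub b⟩
    rw [hrs, hrs] at this
    exact this.trans (edist_le_ediam.trans hH.2.2)
  have : Nonempty (branchUnion v q {k}) := ⟨⟨v, mem_branchUnion v q {k}⟩⟩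
  obtain ⟨x, hx⟩ := H'.exists_edist_eq_eccent_of_finite ⟨v, mem_branchUnion v q {k}⟩
  refine ⟨⟨x, hsub x⟩, x.2, fun z hz => (iInf₂_le H' hcomp).trans ?_⟩
  have hrz : r z = ⟨v, mem_branchUnion v q {k}⟩ := by
    apply Subtype.ext
    rcases hz with hz | hz
    · rw [hr1 z (Or.inl hz), hz]
    · by_cases hzv : (z : V) = v
      · rw [hr1 z (Or.inl hzv), hzv]
      · exact hr2 z fun h => hz (h.resolve_left hzv)
  rw [← hx, ← hrz]
  nth_rewrite 1 [← hrs x]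
  exact hdist _ _

theorem exists_extremal_triple {ι : Type*} (A : Finset ι) (hA : 3 ≤ A.card) {f : ι → ℝ}
    (hf : Function.Injective f) :
    ∃ a ∈ A, ∃ b ∈ A, ∃ c ∈ A, f a < f b ∧ f b < f c := by
  classical
  obtain ⟨c, hc, hcmax⟩ := A.exists_max_image f (Finset.card_pos.mp (by omega))
  have h1 := Finset.card_erase_of_mem hc
  obtain ⟨b, hb, hbmax⟩ := (A.erase c).exists_max_image f (Finset.card_pos.mp (by omega))
  have h2 := Finset.card_erase_of_mem hb
  obtain ⟨a, ha⟩ := Finset.card_pos.mp (show 0 < ((A.erase c).erase b).card by omega)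
  have ha' := Finset.mem_of_mem_erase ha
  exact ⟨a, Finset.mem_of_mem_erase ha', b, Finset.mem_of_mem_erase hb, c, hc,
    lt_of_le_of_ne (hbmax a ha') (hf.ne (Finset.ne_of_mem_erase ha)),
    lt_of_le_of_ne (hcmax b (Finset.mem_of_mem_erase hb)) (hf.ne (Finset.ne_of_mem_erase hb))⟩

/-- If seven branches take part in a completion, then every vertex is so close to `v` that another
branch could be attached at `v`. -/
theorem IsBranching.edist_add_le [Finite V] {G : SimpleGraph V} {v : V} {q : V → I} {y : I → V}
    (hB : G.IsBranching v q y) {D : ℕ} {J : Set I} {H : SimpleGraph (branchUnion v q J)}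
    (hH : IsDiamOuterplanarCompletion D (G.induce (branchUnion v q J)) H) {k : Fin 7 → I}
    (hk : Function.Injective k) (hkJ : ∀ j, k j ∈ J) {r : ℕ∞}
    (hr : ∀ j, r ≤ minEccent D (G.induce (branchUnion v q {k j}))
      ⟨v, mem_branchUnion v q {k j}⟩) (z : branchUnion v q J) :
    H.edist z ⟨v, mem_branchUnion v q J⟩ + r ≤ D := by
  classical
  set w : branchUnion v q J := ⟨v, mem_branchUnion v q J⟩ with hw
  choose x hxk hx using fun j => hB.exists_far_vertex hH (hkJ j)
  obtain ⟨f, hf, hmax⟩ := hH.2.1.exists_nonCrossing w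
  let Y : Fin 7 → branchUnion v q J := fun j =>
    ⟨y (k j), Or.inr (by rw [hB.label_root]; exact hkJ j)⟩
  have hYw : ∀ j, H.Adj w (Y j) := fun j => hH.1 (hB.adj_root (k j))
  have hYinj : Function.Injective Y := fun a b h => hk (by
    have := congrArg (fun u : branchUnion v q J => q u) h
    simpa [Y, hB.label_root] using this)
  have hqY : ∀ j, q (Y j) = k j := fun j => hB.label_root (k j)
  have hD : ∀ a b, H.edist a b ≤ D := fun a b => edist_le_ediam.trans hH.2.2
  have hrw : ∀ j, r ≤ H.edist w (x j) := fun j => (hr j).trans (hx j w (Or.inl rfl))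
  have hfar : ∀ i j, i ≠ j → r ≤ H.edist (Y i) (x j) := fun i j hij =>
    (hr j).trans (hx j _ (Or.inr (by rw [hqY]; exact hk.ne hij)))
  -- the far vertex of a branch is connected to its root without using `v` or other roots
  have hwalk : ∀ j, (x j : V) ≠ v → ∃ p : H.Walk (x j) (Y j),
      ∀ i, i ≠ j → w ∉ p.support ∧ Y i ∉ p.support := by
    intro j hj
    have hqx : q (x j) = k j := (hxk j).resolve_left hj
    have main : ∀ b, ReflTransGen (fun a b => G.Adj a b ∧ a ≠ v ∧ b ≠ v) (x j : V) b →
        b ≠ v ∧ q b = k j ∧ ∃ (hb : b ∈ branchUnion v q J) (p : H.Walk (x j) ⟨b, hb⟩),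
          ∀ i, i ≠ j → w ∉ p.support ∧ Y i ∉ p.support := by
      have hnot : ∀ u : branchUnion v q J, (u : V) ≠ v → q u = k j → ∀ i, i ≠ j →
          w ≠ u ∧ Y i ≠ u := by
        refine fun u hu hqu i hij => ⟨fun h => hu (by rw [← h]), fun h => hij (hk ?_)⟩
        rw [← hqY, h, hqu]
      intro b hb
      induction hb with
      | refl =>
        refine ⟨hj, hqx, (x j).2, Walk.nil, fun i hij => ?_⟩
        have := hnot (x j) hj hqx i hij
        simpa using this
      | @tail b c _ hbc ih =>
        obtain ⟨hbv, hqb, hbm, p, hp⟩ := ih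
        have hqc : q c = k j := by rw [← hqb, hB.label_eq hbc.1 hbv hbc.2.2]
        have hcm : c ∈ branchUnion v q J := Or.inr (by rw [hqc]; exact hkJ j)
        have hadj : H.Adj ⟨b, hbm⟩ ⟨c, hcm⟩ := hH.1 hbc.1
        refine ⟨hbc.2.2, hqc, hcm, p.concat hadj, fun i hij => ?_⟩
        have h1 := hnot ⟨c, hcm⟩ hbc.2.2 hqc i hij
        have h2 := hp i hij
        simp only [Walk.support_concat, List.mem_append, List.mem_singleton,
          not_or]
        exact ⟨⟨h2.1, h1.1⟩, ⟨h2.2, h1.2⟩⟩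
    obtain ⟨-, -, hb, p, hp⟩ := main _ (hB.reach_root _ hj)
    have he : (⟨y (q (x j)), hb⟩ : branchUnion v q J) = Y j := Subtype.ext (by
      simp only [Y, hqx])
    exact ⟨p.copy rfl he, by simpa using hp⟩
  have hsep : ∀ j {a b}, f a < f (Y j) → f (Y j) < f b →
      (∀ p : H.Walk a b, w ∈ p.support ∨ Y j ∈ p.support) ∧
      (∀ p : H.Walk b a, w ∈ p.support ∨ Y j ∈ p.support) := by
    intro j a b ha hb
    refine ⟨fun p => hf.mem_support_of_lt hmax (hYw j) p ha hb, fun p => ?_⟩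
    simpa using hf.mem_support_of_lt hmax (hYw j) p.reverse ha hb
  have hfY : Function.Injective (f ∘ Y) := hf.injective.comp hYinj
  -- The walk of `hwalk` avoids `v` and `Y i`, so the chord between these cannot separate `x j` from
  -- `Y j`.
  have hside : ∀ i j, i ≠ j → (x j : V) ≠ v →
      (f (Y i) < f (Y j) → f (Y i) < f (x j)) ∧ (f (Y j) < f (Y i) → f (x j) < f (Y i)) := by
    intro i j hij hj
    obtain ⟨p, hp⟩ := hwalk j hj
    have hne : f (x j) ≠ f (Y i) := fun h => (hp i hij).2 (by
      rw [← hf.injective h]; exact p.start_mem_support)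
    constructor
    · intro h
      by_contra hcon
      exact ((hsep i (lt_of_le_of_ne (not_lt.mp hcon) hne) h).1 p).elim (hp i hij).1 (hp i hij).2
    · intro h
      by_contra hcon
      exact ((hsep i h (lt_of_le_of_ne (not_lt.mp hcon) hne.symm)).2 p).elim
        (hp i hij).1 (hp i hij).2
  have htriv : ∀ j, (x j : V) = v → H.edist z w + r ≤ D := by
    intro j hj
    have hjw : x j = w := Subtype.ext hj
    have h0 := hrw j
    rw [hjw, edist_self] at h0
    rw [nonpos_iff_eq_zero.mp h0, add_zero]
    exact hD _ _
  -- Seven is 3 + 3 + 1: at most one root coincides with `z`.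
  have hcount : 3 ≤ (Finset.univ.filter fun j => f z < f (Y j)).card ∨
      3 ≤ (Finset.univ.filter fun j => f (Y j) < f z).card := by
    by_contra! hcon
    have h1 : (Finset.univ.filter fun j => f (Y j) = f z).card ≤ 1 :=
      Finset.card_le_one.mpr fun a ha b hb => hfY (by
        simp only [Finset.mem_filter] at ha hb
        exact ha.2.trans hb.2.symm)
    have h2 : (Finset.univ : Finset (Fin 7)) ⊆ (Finset.univ.filter fun j => f z < f (Y j)) ∪
        ((Finset.univ.filter fun j => f (Y j) < f z) ∪
          (Finset.univ.filter fun j => f (Y j) = f z)) := by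
      intro j _
      rcases lt_trichotomy (f z) (f (Y j)) with h | h | h <;> simp [h]
    have h3 := (Finset.card_le_card h2).trans ((Finset.card_union_le _ _).trans
      (Nat.add_le_add_left (Finset.card_union_le _ _) _))
    simp only [Finset.card_univ, Fintype.card_fin] at h3
    omega
  rcases hcount with hc | hc
  · obtain ⟨a, ha, b, hb, c, -, hab, hbc⟩ := exists_extremal_triple _ hc hfY
    simp only [Function.comp] at hab hbc
    by_cases hcv : (x c : V) = v
    · exact htriv c hcv
    have hza : f z < f (Y a) := (Finset.mem_filter.mp ha).2
    have hzb : f z < f (Y b) := (Finset.mem_filter.mp hb).2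
    have hbc' : b ≠ c := fun h => hbc.ne (by rw [h])
    refine (edist_add_le_edist_of_separating (y₁ := Y a) (y₂ := Y b) (hYw a)
      (fun h => hab.ne (by rw [h])) (hsep a hza hab).1
      (hsep b hzb ((hside b c hbc' hcv).1 hbc)).1 (hrw c) (hfar b c hbc')).trans (hD _ _)
  -- The mirror image: negating `f` again lists the three roots going away from `z`.
  · obtain ⟨a, ha, b, hb, c, -, hab, hbc⟩ := exists_extremal_triple _ hc (f := fun j => -f (Y j))
      (fun i j h => hfY (neg_injective h))
    simp only [neg_lt_neg_iff] at hab hbc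
    by_cases hcv : (x c : V) = v
    · exact htriv c hcv
    have hza : f (Y a) < f z := (Finset.mem_filter.mp ha).2
    have hzb : f (Y b) < f z := (Finset.mem_filter.mp hb).2
    have hbc' : b ≠ c := fun h => hbc.ne (by rw [h])
    refine (edist_add_le_edist_of_separating (y₁ := Y a) (y₂ := Y b) (hYw a)
      (fun h => hab.ne (by rw [h])) (hsep a hab hza).2
      (hsep b ((hside b c hbc' hcv).2 hbc) hzb).2 (hrw c) (hfar b c hbc')).trans (hD _ _)

/-! ### From components to branches, and assembly -/

/-- The components of `G - v`, listed by `C`, give a branching of a connected graph. -/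
theorem Connected.exists_isBranching {G : SimpleGraph V} (hG : G.Connected) (v : V) [Nonempty I]
    (C : I ≃ (G.induce ({v}ᶜ : Set V)).ConnectedComponent) :
    ∃ (q : V → I) (y : I → V), G.IsBranching v q y ∧
      ∀ k, G.branch v (C k) = branchUnion v q {k} := by
  classical
  let q : V → I := fun x => if h : x = v then Classical.arbitrary I else
    C.symm ((G.induce ({v}ᶜ : Set V)).connectedComponentMk ⟨x, h⟩)
  have hq : ∀ x (h : x ≠ v),
      q x = C.symm ((G.induce ({v}ᶜ : Set V)).connectedComponentMk ⟨x, h⟩) := fun x h => dif_neg h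
  have hlabel : ∀ ⦃a b⦄, G.Adj a b → a ≠ v → b ≠ v → q a = q b := by
    intro a b hab ha hb
    rw [hq a ha, hq b hb]
    refine congrArg _ (ConnectedComponent.sound (Adj.reachable ?_))
    exact hab
  have hex : ∀ {a b : V} (p : G.Walk a b), b = v → a ≠ v → ∃ u, u ≠ v ∧ G.Adj v u ∧ q u = q a := by
    intro a b p
    induction p with
    | nil => intro h h'; exact absurd h h'
    | @cons a c b h p ih =>
      intro hb ha
      by_cases hc : c = v
      · subst hc
        exact ⟨a, ha, h.symm, rfl⟩
      · obtain ⟨u, hu, hvu, hqu⟩ := ih hb hc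
        exact ⟨u, hu, hvu, hqu.trans (hlabel h ha hc).symm⟩
  have hroot : ∀ k, ∃ u, u ≠ v ∧ G.Adj v u ∧ q u = k := by
    intro k
    obtain ⟨⟨a, ha⟩, hak⟩ := (C k).exists_rep
    obtain ⟨p⟩ := hG.preconnected a v
    obtain ⟨u, hu, hvu, hqu⟩ := hex p rfl ha
    refine ⟨u, hu, hvu, hqu.trans ?_⟩
    rw [hq a ha, Equiv.symm_apply_eq]
    exact hak
  choose y hyv hvy hqy using hroot
  refine ⟨q, y, ⟨hlabel, hqy, hyv, hvy, ?_⟩, ?_⟩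
  · intro x hx
    have h1 := (hq x hx).symm.trans ((hqy (q x)).symm.trans (hq (y (q x)) (hyv _)))
    have h2 := (reachable_iff_reflTransGen _ _).mp (ConnectedComponent.exact (C.symm.injective h1))
    exact h2.lift Subtype.val fun a b hab => ⟨hab, a.2, b.2⟩
  · intro k
    ext x
    simp only [branch, branchUnion, Set.mem_insert_iff, Set.mem_image, Set.mem_ofPred_eq,
      Set.mem_singleton_iff, Subtype.exists]
    by_cases hx : x = v
    · simp [hx]
    · simp only [hx, false_or]
      rw [hq x hx, Equiv.symm_apply_eq]
      constructor
      · rintro ⟨a, ha, hak, rfl⟩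
        exact hak
      · intro h
        exact ⟨x, hx, h, rfl⟩

theorem minEccent_congr {D : ℕ} {G : SimpleGraph V} {v : V} {S T : Set V} (h : S = T) (hS : v ∈ S)
    (hT : v ∈ T) : minEccent D (G.induce S) ⟨v, hS⟩ = minEccent D (G.induce T) ⟨v, hT⟩ := by
  subst h; rfl

theorem exists_completion_congr {D : ℕ} {G : SimpleGraph V} {v : V} {S T : Set V} (h : S = T)
    (hS : v ∈ S) (hT : v ∈ T) {n : ℕ∞}
    (H : ∃ H : SimpleGraph S, IsDiamOuterplanarCompletion D (G.induce S) H ∧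
      H.eccent ⟨v, hS⟩ ≤ n) :
    ∃ H : SimpleGraph T, IsDiamOuterplanarCompletion D (G.induce T) H ∧ H.eccent ⟨v, hT⟩ ≤ n := by
  subst h; exact H

/-- The contraction is onto and shortens distances, so the diameter bound is inherited. The
embedding `e` lets the source be either an induced subgraph or `G` itself. -/
theorem IsBranching.exists_completion_branchUnion [Finite V] {W : Type*} {G : SimpleGraph V} {v : V}
    {q : V → I} {y : I → V} (hB : G.IsBranching v q y) {e : W → V} (he : Function.Injective e)
    {J J' : Set I} (hJ : ∀ x, x ∈ Set.range e ↔ x ∈ branchUnion v q J) (hJJ : J' ⊆ J) {D : ℕ}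
    (h : HasDiamOuterplanarCompletion D (G.comap e)) :
    HasDiamOuterplanarCompletion D (G.induce (branchUnion v q J')) := by
  obtain ⟨H, hGH, hout, hD⟩ := h
  obtain ⟨H', r, h1, h2, h3, -, h4⟩ := hB.exists_contraction he hJ hJJ (fun a b h => hGH h) hout
  refine ⟨H', h1, h2, ediam_le_of_edist_le fun a b => ?_⟩
  have hsub : ∀ a : branchUnion v q J', ∃ c, r c = a := fun a => by
    obtain ⟨c, hc⟩ := (hJ a).2 (a.2.imp id fun h => hJJ h)
    exact ⟨c, Subtype.ext (by rw [h3 c (by rw [hc]; exact a.2), hc])⟩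
  obtain ⟨c, rfl⟩ := hsub a
  obtain ⟨d, rfl⟩ := hsub b
  exact (h4 c d).trans (edist_le_ediam.trans hD)

/-- Seven branches of largest least eccentricity decide whether there is a completion. -/
theorem IsBranching.hasDiamOuterplanarCompletion_of_seven [Finite V] {G : SimpleGraph V} {v : V}
    {t : ℕ} {q : V → Fin t} {y : Fin t → V} (hB : G.IsBranching v q y) (ht : 7 ≤ t) {D : ℕ}
    (hord : ∀ j k : Fin t, j ≤ k →
      minEccent D (G.induce (branchUnion v q {k})) ⟨v, mem_branchUnion v q {k}⟩ ≤
        minEccent D (G.induce (branchUnion v q {j})) ⟨v, mem_branchUnion v q {j}⟩)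
    (h : HasDiamOuterplanarCompletion D
      (G.induce (branchUnion v q {j : Fin t | (j : ℕ) < 7}))) :
    HasDiamOuterplanarCompletion D G := by
  classical
  set J : Set (Fin t) := {j : Fin t | (j : ℕ) < 7} with hJ
  obtain ⟨H, hH⟩ := h
  -- The seventh branch, counting from 0.
  let s : Fin t := ⟨6, by omega⟩
  set ρ : Fin t → ℕ∞ := fun k =>
    minEccent D (G.induce (branchUnion v q {k})) ⟨v, mem_branchUnion v q {k}⟩ with hρ
  have hclose : H.eccent ⟨v, mem_branchUnion v q J⟩ + ρ s ≤ D := by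
    have : Nonempty (branchUnion v q J) := ⟨⟨v, mem_branchUnion v q J⟩⟩
    obtain ⟨z, hz⟩ := H.exists_edist_eq_eccent_of_finite ⟨v, mem_branchUnion v q J⟩
    rw [← hz, SimpleGraph.edist_comm]
    refine hB.edist_add_le hH (k := Fin.castLE ht) (Fin.castLE_injective ht) (fun j => j.2)
      (fun j => hord _ s ?_) z
    exact Fin.le_def.mpr (Nat.lt_succ_iff.mp j.2)
  have hρs : ρ s ≤ H.eccent ⟨v, mem_branchUnion v q J⟩ := by
    obtain ⟨x, -, hx⟩ := hB.exists_far_vertex hH (k := s) (show 6 < 7 by omega)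
    exact (hx ⟨v, mem_branchUnion v q J⟩ (Or.inl rfl)).trans edist_le_eccent
  -- Finiteness passes to all later branches, which therefore have completions attaining their least
  -- eccentricity.
  have hρD : ρ s ≠ ⊤ := by
    refine ne_top_of_le_ne_top (ENat.natCast_ne_top D) (le_trans ?_ hclose)
    exact le_add_self
  -- Taking the maximum with `s` merges the first seven branches into one piece, to be filled by
  -- `H`.
  let q' : V → {k : Fin t // s ≤ k} := fun x => ⟨max (q x) s, le_max_right _ _⟩
  refine hasDiamOuterplanarCompletion_of_pieces (v := v) (q := q')
    (fun a b hab ha hb => Subtype.ext (by simp only [q', hB.label_eq hab ha hb]))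
    (fun k => if (k : Fin t) = s then H.eccent ⟨v, mem_branchUnion v q J⟩ else ρ k) ?_ ?_
  · rintro ⟨k, hk⟩
    by_cases hks : k = s
    · subst hks
      have hset : branchUnion v q J = branchUnion v q' {⟨s, hk⟩} := by
        ext x
        simp only [branchUnion, Set.mem_ofPred_eq, Set.mem_singleton_iff, q', Subtype.mk.injEq,
          max_eq_right_iff, hJ]
        rw [Fin.le_def]
        exact or_congr_right Nat.lt_succ_iff
      refine exists_completion_congr hset (mem_branchUnion v q J) _ ⟨H, hH, ?_⟩
      simp
    · have hset : branchUnion v q {k} = branchUnion v q' {⟨k, hk⟩} := by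
        ext x
        simp only [branchUnion, Set.mem_ofPred_eq, Set.mem_singleton_iff, q', Subtype.mk.injEq]
        have : s < k := lt_of_le_of_ne hk (Ne.symm hks)
        refine or_congr_right ⟨fun h => by rw [h, max_eq_left hk], fun h => ?_⟩
        rcases max_choice (q x) s with h' | h'
        · rw [← h', h]
        · exact absurd (h'.symm.trans h) this.ne
      obtain ⟨K, hK, hKe⟩ := exists_completion_eccent_eq_minEccent
        (ne_top_of_le_ne_top hρD (hord s k hk))
      refine exists_completion_congr hset (mem_branchUnion v q {k}) _ ⟨K, hK, ?_⟩
      simp [hks, hKe, hρ]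
  · rintro ⟨k, hk⟩ ⟨l, hl⟩ hkl
    have hkl' : k ≠ l := fun h => hkl (Subtype.ext h)
    have h1 : ρ k ≤ ρ s := hord s k hk
    have h2 : ρ l ≤ ρ s := hord s l hl
    by_cases hks : k = s
    · have hls : l ≠ s := fun h => hkl' (hks.trans h.symm)
      simp only [hks, hls, if_true, if_false]
      exact (add_le_add le_rfl h2).trans hclose
    · by_cases hls : l = s
      · simp only [hks, hls, if_true, if_false]
        rw [add_comm]
        exact (add_le_add le_rfl h1).trans hclose
      -- For two later branches, `ρ k ≤ ρ s ≤ ecc_H(v)` reduces the sum to the bound `hclose`.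
      · simp only [hks, hls, if_false]
        exact (add_le_add (h1.trans hρs) h2).trans hclose

end SimpleGraph

theorem mainTheorem4 {V : Type*} [Finite V] (G : SimpleGraph V)
    (hconn : G.Connected) (hout : G.IsOuterplanar) (D : ℕ) (v : V)
    (t : ℕ) (ht : 8 ≤ t)
    -- `C` lists the connected components of `G - v`, hence `G.branch v (C j)` lists the branches
    (C : Fin t ≃ (G.induce ({v}ᶜ : Set V)).ConnectedComponent)
    (hord : ∀ j k : Fin t, j ≤ k →
      SimpleGraph.minEccent D (G.induce (G.branch v (C k))) ⟨v, G.mem_branch v (C k)⟩ ≤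
        SimpleGraph.minEccent D (G.induce (G.branch v (C j))) ⟨v, G.mem_branch v (C j)⟩)
    (i : Fin t) (hi : 7 ≤ (i : ℕ)) :
    SimpleGraph.HasDiamOuterplanarCompletion D
        (G.induce (⋃ j ∈ {j : Fin t | (j : ℕ) < 7 ∨ j = i}, G.branch v (C j))) ↔
      SimpleGraph.HasDiamOuterplanarCompletion D G := by
  have : Nonempty (Fin t) := ⟨i⟩
  obtain ⟨q, y, hB, hbranch⟩ := hconn.exists_isBranching v C
  have hset : (⋃ j ∈ {j : Fin t | (j : ℕ) < 7 ∨ j = i}, G.branch v (C j)) =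
      SimpleGraph.branchUnion v q {j : Fin t | (j : ℕ) < 7 ∨ j = i} := by
    ext x
    simp only [hbranch, Set.mem_iUnion, SimpleGraph.branchUnion, Set.mem_ofPred_eq,
      Set.mem_singleton_iff]
    constructor
    · rintro ⟨j, hj, h | h⟩
      · exact Or.inl h
      · exact Or.inr (h ▸ hj)
    · rintro (h | h)
      · exact ⟨i, Or.inr rfl, Or.inl h⟩
      · exact ⟨q x, h, Or.inr rfl⟩
  rw [hset]
  constructor
  · intro h
    refine hB.hasDiamOuterplanarCompletion_of_seven (by omega) (fun j k hjk => ?_)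
      (hB.exists_completion_branchUnion (e := Subtype.val) Subtype.val_injective
        (J := {j : Fin t | (j : ℕ) < 7 ∨ j = i}) (by simp) (fun j hj => Or.inl hj) h)
    have := hord j k hjk
    rwa [SimpleGraph.minEccent_congr (hbranch k) _ (SimpleGraph.mem_branchUnion v q {k}),
      SimpleGraph.minEccent_congr (hbranch j) _ (SimpleGraph.mem_branchUnion v q {j})] at this
  · intro h
    exact hB.exists_completion_branchUnion (e := id) Function.injective_id (J := Set.univ)
      (by simp [SimpleGraph.branchUnion]) (Set.subset_univ _) h
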